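/- **Conventions.** Let $\mathfrak A\neq 0$ be a C*-algebra, let $\mathfrak{uA}$ be the smallest unital C*-algebra containing it ($\mathfrak A$ itself if $\mathfrak A$ is unital, the standard unitization otherwise), and let $1$ be the unit of $\mathfrak{uA}$. Write $\mathfrak{sa}(\cdot)$ for the self-adjoint part and $\mathscr S(\mathfrak A)$ for the state space of $\mathfrak A$; a state of $\mathfrak A$ is identified with its unique extension to a state of $\mathfrak{uA}$ and with the corresponding normal state of the enveloping von Neumann algebra. A *Lipschitz triple* $(\mathfrak A,\mathsf L,\mathfrak M)$ consists of $\mathfrak A$, a seminorm $\mathsf L$ defined on a dense real subspace of $\mathfrak{sa}(\mathfrak{uA})$ (with $\mathsf L(a)=\infty$ for $a$ outside this subspace) such that $\{a\in\mathfrak{sa}(\mathfrak{uA}):\mathsf L(a)=0\}=\mathbb R1$, and an Abelian C*-subalgebra $\mathfrak M\subseteq\mathfrak A$ containing an approximate unit for $\mathfrak A$. Let $\sigma(\mathfrak M)$ be the Gel'fand spectrum of $\mathfrak M$, let $\mathcal C$ be the set of its compact subsets, directed by inclusion, and for $K\in\mathcal C$ let $\chi_K\in\mathfrak M^{**}\subseteq\mathfrak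 A^{**}$ be the indicator function of $K$. Put $\mathscr S(\mathfrak A|K)=\{\varphi\in\mathscr S(\mathfrak A):\varphi(\chi_K)=1\}$. The elements of $\mathscr S(\mathfrak A|\mathfrak M)=\bigcup_{K\in\mathcal C}\mathscr S(\mathfrak A|K)$ are called *local states*. The triple is *regular* if for every $K\in\mathcal C$ the set $\mathscr S(\mathfrak A|K)$ has finite diameter for the extended Monge–Kantorovich metric $$\mathsf{mk}_{\mathsf L}(\varphi,\psi)=\sup\{|\varphi(a)-\psi(a)|:a\in\mathfrak{sa}(\mathfrak A),\ \mathsf L(a)\le1\}.$$ For a local state $\mu$, a set $\mathscr K\subseteq\mathscr S(\mathfrak A)$ is called *tame with respect to $\mu$* if $$\lim_{K\in\mathcal C}\ \sup\{|\varphi(a-\chi_Ka\chi_K)|:\varphi\in\mathscr K,\ a\in\mathfrak{sa}(\mathfrak{uA}),\ \mathsf L(a)\le1,\ \mu(a)=0\}=0,$$ and *tame* if it is tame with respect to some local state. **Theorem.** Let $(\mathfrak A,\mathsf L,\mathfrak M)$ be a regular Lipschitz triple with $\mathfrak A\ne0$. A set $\mathscr K\subseteq\mathscr S(\mathfrak A)$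 is tame if and only if it is tame with respect to every local state. Hence, for any two local states $\mu,\nu$, the set $\mathscr K$ is tame with respect to $\mu$ if and only if it is tame with respect to $\nu$. -/

import Mathlib

open Filter Topology WeakDual
open scoped ComplexOrder ENNReal

namespace QLCMS

/-! ### The minimal unitization -/

/-- `ι : A → B` exhibits `B` as the smallest unital C⋆-algebra containing `A`: `B` is spanned by
`A` and its unit, and if `A` already has a unit then nothing is added. -/
structure IsMinimalUnitization {A B : Type*} [NonUnitalCStarAlgebra A] [CStarAlgebra B]
    (ι : A →⋆ₙₐ[ℂ] B) : Prop where
  injective : Function.Injective ι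
  exists_eq_add_smul_one : ∀ b : B, ∃ (a : A) (t : ℂ), b = ι a + t • (1 : B)
  surjective_of_unital : (∃ e : A, ∀ a : A, e * a = a ∧ a * e = a) → Function.Surjective ι

/-- A unital C⋆-algebra is its own minimal unitization. -/
theorem isMinimalUnitization_id (A : Type*) [CStarAlgebra A] :
    IsMinimalUnitization (NonUnitalStarAlgHom.id ℂ A) where
  injective := fun _ _ h => h
  exists_eq_add_smul_one := fun b => ⟨b, 0, by simp⟩
  surjective_of_unital := fun _ b => ⟨b, rfl⟩

/-- The standard unitization `A ⊕ ℂ` of a C⋆-algebra without unit is its minimal unitization. -/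
theorem isMinimalUnitization_unitization (A : Type*) [NonUnitalCStarAlgebra A]
    (hA : ¬ ∃ e : A, ∀ a : A, e * a = a ∧ a * e = a) :
    IsMinimalUnitization (Unitization.inrNonUnitalStarAlgHom ℂ A) where
  injective := Unitization.inr_injective
  exists_eq_add_smul_one := fun b => ⟨b.snd, b.fst, by
    ext <;> simp⟩
  surjective_of_unital := fun h => absurd h hA

/-! ### The Gelfand spectrum and indicator functions of compact sets in the bidual -/

section Indicator

variable {M : Type*} [NonUnitalCommCStarAlgebra M]

/-- The bidual of a complex normed space. -/
abbrev Bidual (E : Type*) [NormedAddCommGroup E] [NormedSpace ℂ E] : Type _ :=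
  StrongDual ℂ (StrongDual ℂ E)

/-- The elements of `M ≅ C₀(σ(M))` which, as functions on the Gelfand spectrum `σ(M)`, take values
in `[0,1]` and are equal to `1` on `K`. -/
def majorants (K : TopologicalSpace.Compacts (characterSpace ℂ M)) : Set M :=
  {g | (∀ χ : characterSpace ℂ M, 0 ≤ χ g ∧ χ g ≤ 1) ∧ ∀ χ ∈ K, χ g = 1}

/-- The filter of the net of all continuous majorants of the indicator function of `K`, directed
by pointwise decrease. -/
def majorantFilter (K : TopologicalSpace.Compacts (characterSpace ℂ M)) : Filter M :=
  ⨅ g ∈ majorants K, 𝓟 {h | h ∈ majorants K ∧ ∀ χ : characterSpace ℂ M, χ h ≤ χ g}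

/-- The extension of a character of `M` to the unitization of `M`. -/
noncomputable def extendChar (χ : characterSpace ℂ M) : characterSpace ℂ (Unitization ℂ M) :=
  CharacterSpace.equivAlgHom.symm (Unitization.lift (CharacterSpace.toNonUnitalAlgHom χ))

theorem extendChar_apply (χ : characterSpace ℂ M) (x : Unitization ℂ M) :
    extendChar χ x = x.fst + χ x.snd := by
  have h : ∀ f : Unitization ℂ M →ₐ[ℂ] ℂ, (CharacterSpace.equivAlgHom.symm f) x = f x :=
    fun _ => rfl
  rw [extendChar, h]
  simp [Unitization.lift]

theorem norm_le_of_char_le (x : M) {c : ℝ} (hc : 0 ≤ c)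
    (h : ∀ χ : characterSpace ℂ M, ‖χ x‖ ≤ c) : ‖x‖ ≤ c := by
  have h1 : ‖gelfandTransform ℂ (Unitization ℂ M) (x : Unitization ℂ M)‖ = ‖x‖ := by
    rw [(AddMonoidHomClass.isometry_iff_norm _).1 (gelfandTransform_isometry (Unitization ℂ M)),
      Unitization.norm_inr]
  rw [← h1, ContinuousMap.norm_le _ hc]
  intro ψ
  change ‖ψ (x : Unitization ℂ M)‖ ≤ c
  let f : WeakDual ℂ M := StrongDual.toWeakDual
    ((CharacterSpace.toCLM ψ).comp
      (⟨(Unitization.inrNonUnitalAlgHom ℂ M : M →ₗ[ℂ] Unitization ℂ M),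
        Unitization.continuous_inr⟩ : M →L[ℂ] Unitization ℂ M))
  have hf : ∀ y : M, f y = ψ (y : Unitization ℂ M) := fun _ => rfl
  by_cases h0 : f = 0
  · rw [← hf, h0]; exact (norm_zero (E := ℂ)).le.trans hc
  · have := h ⟨f, h0, fun y z => by simp [hf]⟩
    exact this

theorem char_star (χ : characterSpace ℂ M) (x : M) : χ (star x) = star (χ x) := by
  have := map_star (extendChar χ) (x : Unitization ℂ M)
  rw [← Unitization.inr_star, extendChar_apply, extendChar_apply] at this
  simpa using this

theorem isInducing_extendChar : IsInducing (extendChar : characterSpace ℂ M → _) := by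
  have hc : Continuous (extendChar : characterSpace ℂ M → _) := by
    refine Continuous.subtype_mk (WeakDual.continuous_of_continuous_eval fun x => ?_) _
    have : (fun χ : characterSpace ℂ M => extendChar χ x) = fun χ => x.fst + χ x.snd :=
      funext fun χ => extendChar_apply χ x
    change Continuous fun χ : characterSpace ℂ M => extendChar χ x
    rw [this]
    exact continuous_const.add ((WeakDual.eval_continuous x.snd).comp continuous_subtype_val)
  let r : characterSpace ℂ (Unitization ℂ M) → WeakDual ℂ M := fun ψ => StrongDual.toWeakDual
    ((CharacterSpace.toCLM ψ).comp
      (⟨(Unitization.inrNonUnitalAlgHom ℂ M : M →ₗ[ℂ] Unitization ℂ M),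
        Unitization.continuous_inr⟩ : M →L[ℂ] Unitization ℂ M))
  have hr : Continuous r := WeakDual.continuous_of_continuous_eval fun y =>
    (WeakDual.eval_continuous (y : Unitization ℂ M)).comp continuous_subtype_val
  refine IsInducing.of_comp hc hr ?_
  have : r ∘ extendChar = (Subtype.val : characterSpace ℂ M → WeakDual ℂ M) := by
    funext χ
    refine DFunLike.ext _ _ fun y => ?_
    change extendChar χ (y : Unitization ℂ M) = χ y
    rw [extendChar_apply]; simp
  rw [this]
  exact IsInducing.subtypeVal

/-- Urysohn's lemma on the Gelfand spectrum. -/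
theorem exists_majorant (K : TopologicalSpace.Compacts (characterSpace ℂ M))
    {U : Set (characterSpace ℂ M)} (hU : IsOpen U) (hKU : (K : Set _) ⊆ U) :
    ∃ g ∈ majorants K, ∀ χ, χ ∉ U → χ g = 0 := by
  obtain ⟨V, hV, hVU⟩ := isInducing_extendChar.isOpen_iff.1 hU
  let inf : characterSpace ℂ (Unitization ℂ M) :=
    CharacterSpace.equivAlgHom.symm (Unitization.fstHom ℂ M)
  have hinf : ∀ x, inf x = x.fst := fun _ => rfl
  have hne : ∀ χ : characterSpace ℂ M, extendChar χ ≠ inf := by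
    intro χ h
    refine χ.2.1 (DFunLike.ext _ _ fun y => ?_)
    have := DFunLike.congr_fun h (y : Unitization ℂ M)
    rw [extendChar_apply, hinf, Unitization.fst_inr, Unitization.snd_inr, zero_add] at this
    exact this
  have hc1 : IsClosed (extendChar '' (K : Set (characterSpace ℂ M))) :=
    (K.isCompact.image isInducing_extendChar.continuous).isClosed
  have hc2 : IsClosed (Vᶜ ∪ {inf}) := hV.isClosed_compl.union isClosed_singleton
  have hd : Disjoint (Vᶜ ∪ {inf}) (extendChar '' (K : Set (characterSpace ℂ M))) := by
    rw [Set.disjoint_right]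
    rintro _ ⟨χ, hχ, rfl⟩ (h | h)
    · exact h (hVU ▸ hKU hχ : χ ∈ extendChar ⁻¹' V)
    · exact hne χ h
  obtain ⟨f, hf0, hf1, hf01⟩ := exists_continuous_zero_one_of_isClosed hc2 hc1 hd
  let F : C(characterSpace ℂ (Unitization ℂ M), ℂ) := ⟨fun ψ => (f ψ : ℂ), by fun_prop⟩
  obtain ⟨x, hx⟩ := (gelfandTransform_bijective (Unitization ℂ M)).2 F
  have hx' : ∀ ψ : characterSpace ℂ (Unitization ℂ M), ψ x = (f ψ : ℂ) := fun ψ =>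
    DFunLike.congr_fun hx ψ
  have hfst : x.fst = 0 := by
    rw [← hinf, hx', hf0 (Or.inr rfl)]; simp
  have hχ : ∀ χ : characterSpace ℂ M, χ x.snd = (f (extendChar χ) : ℂ) := fun χ => by
    rw [← hx', extendChar_apply, hfst, zero_add]
  refine ⟨x.snd, ⟨fun χ => ?_, fun χ hK => ?_⟩, fun χ hU' => ?_⟩
  · rw [hχ]
    exact ⟨by exact_mod_cast (hf01 _).1, by exact_mod_cast (hf01 _).2⟩
  · rw [hχ, hf1 ⟨χ, hK, rfl⟩]; simp
  · have : extendChar χ ∈ Vᶜ := fun h => hU' (hVU ▸ h : χ ∈ U)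
    rw [hχ, hf0 (Or.inl this)]; simp

theorem majorant_mul {K : TopologicalSpace.Compacts (characterSpace ℂ M)} {g h : M}
    (hg : g ∈ majorants K) (hh : h ∈ majorants K) :
    g * h ∈ majorants K ∧ (∀ χ : characterSpace ℂ M, χ (g * h) ≤ χ g) ∧
      ∀ χ : characterSpace ℂ M, χ (g * h) ≤ χ h := by
  refine ⟨⟨fun χ => ?_, fun χ hχ => ?_⟩, fun χ => ?_, fun χ => ?_⟩
  · rw [map_mul]
    exact ⟨mul_nonneg (hg.1 χ).1 (hh.1 χ).1, mul_le_one₀ (hg.1 χ).2 (hh.1 χ).1 (hh.1 χ).2⟩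
  · rw [map_mul, hg.2 χ hχ, hh.2 χ hχ, mul_one]
  · rw [map_mul]; exact mul_le_of_le_one_right (hg.1 χ).1 (hh.1 χ).2
  · rw [map_mul]; exact mul_le_of_le_one_left (hh.1 χ).1 (hg.1 χ).2

theorem hasBasis_majorantFilter (K : TopologicalSpace.Compacts (characterSpace ℂ M)) :
    (majorantFilter K).HasBasis (fun g => g ∈ majorants K)
      (fun g => {h | h ∈ majorants K ∧ ∀ χ : characterSpace ℂ M, χ h ≤ χ g}) := by
  refine hasBasis_biInf_principal ?_ ?_
  · intro g hg h hh
    obtain ⟨h1, h2, h3⟩ := majorant_mul hg hh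
    exact ⟨g * h, h1, fun x hx => ⟨hx.1, fun χ => (hx.2 χ).trans (h2 χ)⟩,
      fun x hx => ⟨hx.1, fun χ => (hx.2 χ).trans (h3 χ)⟩⟩
  · obtain ⟨g, hg, -⟩ := exists_majorant K isOpen_univ (Set.subset_univ _)
    exact ⟨g, hg⟩

instance majorantFilter_neBot (K : TopologicalSpace.Compacts (characterSpace ℂ M)) :
    (majorantFilter K).NeBot :=
  (hasBasis_majorantFilter K).neBot_iff.2 fun {g} hg => ⟨g, hg, fun _ => le_rfl⟩

theorem norm_le_one_of_majorant {K : TopologicalSpace.Compacts (characterSpace ℂ M)} {g : M}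
    (hg : g ∈ majorants K) : ‖g‖ ≤ 1 :=
  norm_le_of_char_le g zero_le_one fun χ => by
    have h := CStarAlgebra.norm_le_norm_of_nonneg_of_le (hg.1 χ).1 (hg.1 χ).2
    simpa using h

/-- The total variation of a functional on the order interval below `g`. -/
noncomputable def variation (f : StrongDual ℂ M) (g : M) : ℝ :=
  sSup {r | ∃ x : M, (∀ χ : characterSpace ℂ M, (‖χ x‖ : ℂ) ≤ χ g) ∧ r = ‖f x‖}

theorem variation_bddAbove (f : StrongDual ℂ M) {K : TopologicalSpace.Compacts (characterSpace ℂ M)}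
    {g : M} (hg : g ∈ majorants K) :
    BddAbove {r | ∃ x : M, (∀ χ : characterSpace ℂ M, (‖χ x‖ : ℂ) ≤ χ g) ∧ r = ‖f x‖} := by
  refine ⟨‖f‖, ?_⟩
  rintro _ ⟨x, hx, rfl⟩
  refine f.unit_le_opNorm x (norm_le_of_char_le x zero_le_one fun χ => ?_)
  exact_mod_cast (hx χ).trans (hg.1 χ).2

theorem le_variation (f : StrongDual ℂ M) {K : TopologicalSpace.Compacts (characterSpace ℂ M)}
    {g : M} (hg : g ∈ majorants K) {x : M} (hx : ∀ χ : characterSpace ℂ M, (‖χ x‖ : ℂ) ≤ χ g) :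
    ‖f x‖ ≤ variation f g :=
  le_csSup (variation_bddAbove f hg) ⟨x, hx, rfl⟩

theorem exists_rotation (z : ℂ) : ∃ c : ℂ, ‖c‖ = 1 ∧ c * z = ‖z‖ := by
  by_cases hz : z = 0
  · exact ⟨1, by simp, by simp [hz]⟩
  · refine ⟨‖z‖ / z, by simp [hz], by field_simp⟩

theorem norm_sub_add_variation_le (f : StrongDual ℂ M)
    {K : TopologicalSpace.Compacts (characterSpace ℂ M)} {g h : M} (hg : g ∈ majorants K)
    (hh : h ∈ majorants K) (hle : ∀ χ : characterSpace ℂ M, χ h ≤ χ g) :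
    ‖f (g - h)‖ + variation f h ≤ variation f g := by
  rw [← le_sub_iff_add_le']
  refine csSup_le ⟨_, 0, fun χ => by simpa using (hh.1 χ).1, rfl⟩ ?_
  rintro _ ⟨x, hx, rfl⟩
  obtain ⟨c, hc, hc'⟩ := exists_rotation (f (g - h))
  obtain ⟨d, hd, hd'⟩ := exists_rotation (f x)
  have key : ‖f (c • (g - h) + d • x)‖ = ‖f (g - h)‖ + ‖f x‖ := by
    rw [map_add, map_smul, map_smul, smul_eq_mul, smul_eq_mul, hc', hd', ← Complex.ofReal_add,
      Complex.norm_real, Real.norm_of_nonneg (by positivity)]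
  rw [le_sub_iff_add_le', ← key]
  refine le_variation f hg fun χ => ?_
  have h1 : (‖χ (g - h)‖ : ℂ) = χ g - χ h := by
    rw [map_sub]
    have h2 := sub_nonneg.2 (hle χ)
    exact Complex.norm_of_nonneg' h2
  have h3 : ‖χ (c • (g - h) + d • x)‖ ≤ ‖χ (g - h)‖ + ‖χ x‖ := by
    rw [map_add, map_smul, map_smul]
    refine (norm_add_le _ _).trans ?_
    rw [norm_smul, norm_smul, hc, hd, one_mul, one_mul]
  have h4 : (‖χ (c • (g - h) + d • x)‖ : ℂ) ≤ (‖χ (g - h)‖ : ℂ) + (‖χ x‖ : ℂ) := by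
    exact_mod_cast h3
  refine h4.trans ?_
  rw [h1]
  calc χ g - χ h + (‖χ x‖ : ℂ) ≤ χ g - χ h + χ h := by gcongr; exact hx χ
    _ = χ g := by ring

/-- Every bounded functional converges along the decreasing net of majorants of `K`. -/
theorem exists_tendsto_majorantFilter (K : TopologicalSpace.Compacts (characterSpace ℂ M))
    (f : StrongDual ℂ M) : ∃ z : ℂ, Tendsto f (majorantFilter K) (𝓝 z) := by
  refine cauchy_map_iff_exists_tendsto.1 (Metric.cauchy_iff.2 ⟨inferInstance, fun ε hε => ?_⟩)
  set S : Set ℝ := variation f '' majorants K with hS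
  have hne : S.Nonempty := by
    obtain ⟨g, hg, -⟩ := exists_majorant K isOpen_univ (Set.subset_univ _)
    exact ⟨_, g, hg, rfl⟩
  have hbd : BddBelow S := by
    refine ⟨0, ?_⟩
    rintro _ ⟨g, hg, rfl⟩
    exact (norm_nonneg _).trans (le_variation f hg (x := 0) fun χ => by simpa using (hg.1 χ).1)
  obtain ⟨_, ⟨g, hg, rfl⟩, hlt⟩ := exists_lt_of_csInf_lt hne
    (lt_add_of_pos_right (sInf S) (half_pos hε))
  have hclose : ∀ h ∈ majorants K, (∀ χ : characterSpace ℂ M, χ h ≤ χ g) →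
      dist (f g) (f h) < ε / 2 := by
    intro h hh hle
    have h1 := norm_sub_add_variation_le f hg hh hle
    have h2 : sInf S ≤ variation f h := csInf_le hbd ⟨h, hh, rfl⟩
    rw [dist_eq_norm, ← map_sub]
    linarith
  refine ⟨_, image_mem_map ((hasBasis_majorantFilter K).mem_of_mem hg), ?_⟩
  rintro _ ⟨h, hh, rfl⟩ _ ⟨h', hh', rfl⟩
  calc dist (f h) (f h') ≤ dist (f g) (f h) + dist (f g) (f h') := dist_triangle_left _ _ _
    _ < ε / 2 + ε / 2 := add_lt_add (hclose h hh.1 hh.2) (hclose h' hh'.1 hh'.2)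
    _ = ε := add_halves ε

theorem tendsto_limUnder_majorantFilter (K : TopologicalSpace.Compacts (characterSpace ℂ M))
    (f : StrongDual ℂ M) : Tendsto f (majorantFilter K) (𝓝 (limUnder (majorantFilter K) f)) :=
  tendsto_nhds_limUnder (exists_tendsto_majorantFilter K f)

/-- The indicator function `1_K` of a compact subset `K` of the Gelfand spectrum, as an element of
the bidual of `M`: the weak-star limit of the decreasing net of all continuous functions `g` with
`1_K ≤ g ≤ 1`. On a functional given by a Radon measure `μ` its value is `μ(K)`, see
`indicator_eq_measure`. -/
noncomputable def indicator (K : TopologicalSpace.Compacts (characterSpace ℂ M)) : Bidual M :=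
  LinearMap.mkContinuous
    { toFun := fun f => limUnder (majorantFilter K) f
      map_add' := fun f f' => tendsto_nhds_unique (tendsto_limUnder_majorantFilter K (f + f'))
        ((tendsto_limUnder_majorantFilter K f).add (tendsto_limUnder_majorantFilter K f'))
      map_smul' := fun c f => tendsto_nhds_unique (tendsto_limUnder_majorantFilter K (c • f))
        ((tendsto_limUnder_majorantFilter K f).const_smul c) } 1 (fun f => by
      refine le_of_tendsto (tendsto_limUnder_majorantFilter K f).norm ?_
      obtain ⟨g, hg, -⟩ := exists_majorant K isOpen_univ (Set.subset_univ _)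
      filter_upwards [(hasBasis_majorantFilter K).mem_of_mem hg] with h hh
      rw [one_mul]
      exact f.unit_le_opNorm h (norm_le_one_of_majorant hh.1))

theorem tendsto_indicator (K : TopologicalSpace.Compacts (characterSpace ℂ M))
    (f : StrongDual ℂ M) : Tendsto f (majorantFilter K) (𝓝 (indicator K f)) :=
  tendsto_limUnder_majorantFilter K f

open MeasureTheory in
theorem indicator_eq_measure [MeasurableSpace (characterSpace ℂ M)]
    [BorelSpace (characterSpace ℂ M)] (μ : Measure (characterSpace ℂ M)) [IsFiniteMeasure μ]
    [μ.Regular] (f : StrongDual ℂ M) (hf : ∀ g : M, f g = ∫ χ, χ g ∂μ)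
    (K : TopologicalSpace.Compacts (characterSpace ℂ M)) : indicator K f = μ.real K := by
  refine tendsto_nhds_unique (tendsto_indicator K f) (Metric.tendsto_nhds.2 fun ε hε => ?_)
  obtain ⟨U, hKU, hU, hμ⟩ := (K : Set (characterSpace ℂ M)).exists_isOpen_lt_add (μ := μ)
    (measure_ne_top μ _) (ε := ENNReal.ofReal ε) (by simpa using hε)
  have hμ' : μ.real U < μ.real K + ε := by
    have := (ENNReal.toReal_lt_toReal (measure_ne_top μ _) (by finiteness)).2 hμ
    rwa [ENNReal.toReal_add (measure_ne_top μ _) (by finiteness),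
      ENNReal.toReal_ofReal hε.le] at this
  obtain ⟨g, hg, hgU⟩ := exists_majorant K hU hKU
  filter_upwards [(hasBasis_majorantFilter K).mem_of_mem hg] with h hh
  have hcont : Continuous fun χ : characterSpace ℂ M => (χ h).re :=
    Complex.continuous_re.comp ((WeakDual.eval_continuous h).comp continuous_subtype_val)
  have hre : ∀ χ : characterSpace ℂ M, χ h = ((χ h).re : ℂ) := fun χ =>
    Complex.eq_re_of_ofReal_le (r := 0) (by simpa using (hh.1.1 χ).1)
  have h0 : ∀ χ : characterSpace ℂ M, 0 ≤ (χ h).re := fun χ => (Complex.le_def.1 (hh.1.1 χ).1).1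
  have h1 : ∀ χ : characterSpace ℂ M, (χ h).re ≤ 1 := fun χ => by
    simpa using (Complex.le_def.1 (hh.1.1 χ).2).1
  have hint : Integrable (fun χ : characterSpace ℂ M => (χ h).re) μ :=
    Integrable.of_bound hcont.aestronglyMeasurable 1
      (Eventually.of_forall fun χ => by rw [Real.norm_of_nonneg (h0 χ)]; exact h1 χ)
  have hfh : f h = ((∫ χ, (χ h).re ∂μ : ℝ) : ℂ) := by
    rw [hf, ← integral_complex_ofReal]
    exact integral_congr_ae (Eventually.of_forall hre)
  have hKm : MeasurableSet (K : Set (characterSpace ℂ M)) := K.isCompact.measurableSet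
  have lower : μ.real K ≤ ∫ χ, (χ h).re ∂μ := by
    rw [← integral_indicator_one hKm]
    refine integral_mono ((integrable_const 1).indicator hKm) hint fun χ => ?_
    by_cases hχ : χ ∈ (K : Set (characterSpace ℂ M))
    · simp [hχ, hh.1.2 χ hχ]
    · simpa [hχ] using h0 χ
  have upper : ∫ χ, (χ h).re ∂μ ≤ μ.real U := by
    rw [← integral_indicator_one hU.measurableSet]
    refine integral_mono hint ((integrable_const 1).indicator hU.measurableSet) fun χ => ?_
    by_cases hχ : χ ∈ U
    · simpa [hχ] using h1 χ
    · have := (Complex.le_def.1 (hh.2 χ)).1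
      rw [hgU χ hχ] at this
      simpa [hχ] using this
  rw [hfh, dist_eq_norm, ← Complex.ofReal_sub, Complex.norm_real, Real.norm_eq_abs, abs_lt]
  constructor <;> linarith

end Indicator

/-! ### The bidual as an algebra -/

section Bidual

/-- The second transpose `E** → F**` of a bounded linear map `E → F`. -/
noncomputable def bidualMap {E F : Type*} [NormedAddCommGroup E] [NormedSpace ℂ E]
    [NormedAddCommGroup F] [NormedSpace ℂ F] (T : E →L[ℂ] F) (x : Bidual E) : Bidual F :=
  x.comp ((ContinuousLinearMap.compL ℂ E F ℂ).flip T)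

/-- The Arens product on the bidual of an algebra, which for a C⋆-algebra is the multiplication of
its enveloping von Neumann algebra: `(x y)(f) = x (a ↦ y (b ↦ f (a b)))`. -/
noncomputable def arensMul {B : Type*} [CStarAlgebra B] (x y : Bidual B) : Bidual B :=
  x.comp ((ContinuousLinearMap.compL ℂ B (StrongDual ℂ B) ℂ y).comp
    (((ContinuousLinearMap.compL ℂ B (B →L[ℂ] B) (StrongDual ℂ B)).flip
      (ContinuousLinearMap.mul ℂ B)).comp (ContinuousLinearMap.compL ℂ B B ℂ)))

theorem arensMul_apply {B : Type*} [CStarAlgebra B] (x y : Bidual B) (f : StrongDual ℂ B) :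
    arensMul x y f =
      x (y.comp ((ContinuousLinearMap.compL ℂ B B ℂ f).comp (ContinuousLinearMap.mul ℂ B))) :=
  rfl

/-- The Arens product extends the multiplication of `B`. -/
theorem arensMul_inclusion {B : Type*} [CStarAlgebra B] (a b : B) :
    arensMul (NormedSpace.inclusionInDoubleDual ℂ B a) (NormedSpace.inclusionInDoubleDual ℂ B b) =
      NormedSpace.inclusionInDoubleDual ℂ B (a * b) :=
  rfl

end Bidual

/-- A ⋆-homomorphism of C⋆-algebras as a bounded linear map. -/
noncomputable def homToCLM {A B : Type*} [NonUnitalCStarAlgebra A] [NonUnitalCStarAlgebra B]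
    (f : A →⋆ₙₐ[ℂ] B) : A →L[ℂ] B :=
  ((f : A →ₙₐ[ℂ] B) : A →ₗ[ℂ] B).mkContinuous 1
    fun a => by rw [one_mul]; exact NonUnitalStarAlgHom.norm_apply_le f a

/-! ### Lipschitz triples -/

/-- A Lipschitz pair `(A, L)`, where `B` is the minimal unitization of `A`: a seminorm `L` on a
dense real subspace of the self-adjoint part of `B`, vanishing exactly on `ℝ 1`. -/
structure LipschitzPair (A B : Type*) [NonUnitalCStarAlgebra A] [CStarAlgebra B] where
  incl : A →⋆ₙₐ[ℂ] B
  isMinimalUnitization : IsMinimalUnitization incl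
  domain : Submodule ℝ (selfAdjoint B)
  dense_domain : Dense (domain : Set (selfAdjoint B))
  lip : Seminorm ℝ domain
  lip_eq_zero_iff : ∀ a : selfAdjoint B,
    (∃ ha : a ∈ domain, lip ⟨a, ha⟩ = 0) ↔ ∃ t : ℝ, a = t • (1 : selfAdjoint B)

/-- A Lipschitz triple `(A, L, M)`: a Lipschitz pair `(A, L)` with an Abelian C⋆-subalgebra `M`
of `A` which contains an approximate unit for `A`. -/
structure LipschitzTriple (A M B : Type*) [NonUnitalCStarAlgebra A] [NonUnitalCommCStarAlgebra M]
    [CStarAlgebra B] extends LipschitzPair A B where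
  topography : M →⋆ₙₐ[ℂ] A
  topography_injective : Function.Injective topography
  exists_approximateUnit : ∃ l : Filter A, l.IsApproximateUnit ∧ Set.range topography ∈ l

namespace LipschitzPair

variable {A B : Type*} [NonUnitalCStarAlgebra A] [CStarAlgebra B] (P : LipschitzPair A B)

/-- The set of self-adjoint `b` in the unitization with `L(b) ≤ 1`, where `L = ∞` outside of the
domain. -/
def lipBall : Set B :=
  {b | ∃ (hb : IsSelfAdjoint b) (hd : (⟨b, hb⟩ : selfAdjoint B) ∈ P.domain),
    P.lip ⟨⟨b, hb⟩, hd⟩ ≤ 1}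

/-- The elements `b` of the unitization with `L(b) ≤ 1` and `μ(b) = 0`. -/
def lipBallAt (μ : StrongDual ℂ B) : Set B :=
  {b | b ∈ P.lipBall ∧ μ b = 0}

/-- The state space of `A`. A state of `A` is identified with its unique extension to a state of
the unitization `B`; the states of `B` which arise are those of norm one on `A`. -/
def stateSpace : Set (StrongDual ℂ B) :=
  {φ | (∀ b : B, 0 ≤ φ (star b * b)) ∧ φ 1 = 1 ∧ ‖φ.comp (homToCLM P.incl)‖ = 1}

/-- The extended Monge-Kantorovich metric. -/
noncomputable def mongeKantorovich (φ ψ : StrongDual ℂ B) : ℝ≥0∞ :=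
  ⨆ (a : A) (_ : IsSelfAdjoint a) (_ : P.incl a ∈ P.lipBall), ‖φ (P.incl a) - ψ (P.incl a)‖ₑ

end LipschitzPair

namespace LipschitzTriple

variable {A M B : Type*} [NonUnitalCStarAlgebra A] [NonUnitalCommCStarAlgebra M] [CStarAlgebra B]
  (T : LipschitzTriple A M B)

/-- The indicator function of a compact subset of `σ(M)`, as an element of `B**` through the
inclusion `M** ⊆ B**`. -/
noncomputable def ind (K : TopologicalSpace.Compacts (characterSpace ℂ M)) : Bidual B :=
  bidualMap (homToCLM (T.incl.comp T.topography)) (indicator K)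

/-- The element `1_K b 1_K` of the bidual. -/
noncomputable def corner (K : TopologicalSpace.Compacts (characterSpace ℂ M)) (b : B) : Bidual B :=
  arensMul (arensMul (T.ind K) (NormedSpace.inclusionInDoubleDual ℂ B b)) (T.ind K)

/-- The states `φ` of `A` with `φ(1_K) = 1`. -/
def localStatesOn (K : TopologicalSpace.Compacts (characterSpace ℂ M)) : Set (StrongDual ℂ B) :=
  {φ | φ ∈ T.stateSpace ∧ T.ind K φ = 1}

/-- The local state space. -/
def localStates : Set (StrongDual ℂ B) :=
  ⋃ K : TopologicalSpace.Compacts (characterSpace ℂ M), T.localStatesOn K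

/-- A Lipschitz triple is regular when each set of states supported on a compact set has finite
diameter for the extended Monge-Kantorovich metric. -/
def IsRegular : Prop :=
  ∀ K : TopologicalSpace.Compacts (characterSpace ℂ M),
    (⨆ φ ∈ T.localStatesOn K, ⨆ ψ ∈ T.localStatesOn K, T.mongeKantorovich φ ψ) < ∞

/-- Tameness of a set of states with respect to the base state `μ`: the supremum of
`|φ(a - 1_K a 1_K)|` over `φ ∈ 𝒦` and all `a` with `L(a) ≤ 1` and `μ(a) = 0` tends to `0` along the
compact subsets `K` of `σ(M)` directed by inclusion. -/
def IsTameAt (μ : StrongDual ℂ B) (𝒦 : Set (StrongDual ℂ B)) : Prop :=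
  Tendsto (fun K : TopologicalSpace.Compacts (characterSpace ℂ M) =>
    ⨆ a ∈ T.lipBallAt μ, ⨆ φ ∈ 𝒦,
      ‖(NormedSpace.inclusionInDoubleDual ℂ B a - T.corner K a) φ‖ₑ) atTop (𝓝 0)

/-- A set of states is tame when it is tame with respect to some local state. -/
def IsTame (𝒦 : Set (StrongDual ℂ B)) : Prop :=
  ∃ μ ∈ T.localStates, T.IsTameAt μ 𝒦

end LipschitzTriple
end QLCMS

/-! Write $d_K(\varphi,a)=\varphi(a-\chi_Ka\chi_K)$, which is `defect`. Let $\mathscr K$ be tame at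
$\nu$ and let $\mu$ be another local state. If $\mathsf L(a)\le1$ and $\mu(a)=0$, put $t=\nu(a)$.
Then $a-t1$ is a test element for $\nu$, and $d_K(\varphi,a)=d_K(\varphi,a-t1)+t\,d_K(\varphi,1)$.
The first term is small by tameness at $\nu$. Regularity bounds $|t|$ by $D=\mathsf{mk}_{\mathsf
L}(\nu,\mu)<\infty$, uniformly in $a$: any two local states live on a common compact set
(`localStatesOn_mono`). So everything reduces to tightness: $d_K(\varphi,1)=\varphi(1-\chi_K)\to0$
uniformly on $\mathscr K$ (`IsTameAt.tight`).

Tightness follows from tameness at $\nu$ alone, without regularity. Choose a compactly supported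
$k\in\mathfrak M$ with $\nu(k)\approx1$. By density $1-k$ is close to some $a$ with $\mathsf
L(a)<\infty$, and $\nu(a)\approx0$. A multiple of $a-\nu(a)1$ is a test element for $\nu$, so
$d_K(\varphi,1-k)$ is eventually uniformly small. Finally $d_K(\varphi,k)=0$ once $K$ contains the
support of $k$ (`defect_eq_zero`).

For "tame at every local state implies tame" some local state must exist (`localStates_nonempty`): a
Hahn–Banach extension of a character of $\mathfrak M$. -/

namespace QLCMS

/-! ### Functions on the Gelfand spectrum -/

section Majorants

variable {M : Type*} [NonUnitalCommCStarAlgebra M]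

theorem eq_of_forall_char_eq {x y : M} (h : ∀ χ : characterSpace ℂ M, χ x = χ y) : x = y := by
  rw [← sub_eq_zero, ← norm_le_zero_iff]
  exact norm_le_of_char_le _ le_rfl fun χ => by rw [map_sub, h, sub_self, norm_zero]

/-- Every character of the unitization which does not vanish on `M` extends a character of `M`. -/
theorem exists_extendChar_eq (ψ : characterSpace ℂ (Unitization ℂ M)) {x : M}
    (hx : ψ (x : Unitization ℂ M) ≠ 0) : ∃ χ : characterSpace ℂ M, extendChar χ = ψ := by
  let f : WeakDual ℂ M := StrongDual.toWeakDual
    ((CharacterSpace.toCLM ψ).comp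
      (⟨(Unitization.inrNonUnitalAlgHom ℂ M : M →ₗ[ℂ] Unitization ℂ M),
        Unitization.continuous_inr⟩ : M →L[ℂ] Unitization ℂ M))
  have hf : ∀ y : M, f y = ψ (y : Unitization ℂ M) := fun _ => rfl
  have h0 : f ≠ 0 := fun h => hx (by rw [← hf, h]; rfl)
  refine ⟨⟨f, h0, fun y z => by simp [hf]⟩, DFunLike.ext _ _ fun z => ?_⟩
  rw [extendChar_apply]
  change z.fst + ψ (z.snd : Unitization ℂ M) = ψ z
  conv_rhs => rw [← Unitization.inl_fst_add_inr_snd_eq z, map_add]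
  congr 1
  have h1 : (Unitization.inl z.fst : Unitization ℂ M) = algebraMap ℂ _ z.fst := rfl
  rw [h1, AlgHomClass.commutes]
  rfl

/-- Elements of `M` vanish at infinity on the Gelfand spectrum. -/
theorem isCompact_superlevel (x : M) {c : ℝ} (hc : 0 < c) :
    IsCompact {χ : characterSpace ℂ M | c ≤ (χ x).re} := by
  rw [isInducing_extendChar.isCompact_iff]
  -- Since $c>0$, the character at infinity is excluded, so passing to the compact spectrum of the
  -- unitization adds no points to the superlevel set.
  have h : extendChar '' {χ : characterSpace ℂ M | c ≤ (χ x).re} =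
      {ψ : characterSpace ℂ (Unitization ℂ M) | c ≤ (ψ (x : Unitization ℂ M)).re} := by
    ext ψ
    constructor
    · rintro ⟨χ, hχ, rfl⟩
      simpa [extendChar_apply] using hχ
    · intro hψ
      obtain ⟨χ, rfl⟩ := exists_extendChar_eq ψ (x := x) fun h0 => by
        rw [Set.mem_ofPred_eq, h0] at hψ
        exact absurd hψ (by simpa using hc)
      exact ⟨χ, by simpa [extendChar_apply] using hψ, rfl⟩
  rw [h]
  refine IsClosed.isCompact (isClosed_le continuous_const (Complex.continuous_re.comp ?_))
  exact (WeakDual.eval_continuous (x : Unitization ℂ M)).comp continuous_subtype_val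

/-- Every compact set has arbitrarily small majorants of compact support. -/
theorem exists_compactly_supported_majorant (K : TopologicalSpace.Compacts (characterSpace ℂ M)) :
    ∃ K₁ : TopologicalSpace.Compacts (characterSpace ℂ M), ∃ᶠ k in majorantFilter K,
      ∀ χ, χ ∉ K₁ → χ k = 0 := by
  obtain ⟨g, hg, -⟩ := exists_majorant K isOpen_univ (Set.subset_univ _)
  have hcont : Continuous fun χ : characterSpace ℂ M => (χ g).re :=
    Complex.continuous_re.comp ((WeakDual.eval_continuous g).comp continuous_subtype_val)
  obtain ⟨k, hk, hk0⟩ := exists_majorant K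
    (U := {χ : characterSpace ℂ M | (1 / 2 : ℝ) < (χ g).re})
    (isOpen_lt continuous_const hcont) fun χ hχ => by
      rw [Set.mem_ofPred_eq, hg.2 χ hχ]; norm_num
  refine ⟨⟨_, isCompact_superlevel g (c := 1 / 2) (by norm_num)⟩, ?_⟩
  rw [(hasBasis_majorantFilter K).frequently_iff]
  intro h hh
  refine ⟨h * k, ⟨(majorant_mul hh hk).1, (majorant_mul hh hk).2.1⟩, fun χ hχ => ?_⟩
  rw [map_mul, hk0 χ fun h' => hχ (le_of_lt h' : (1 / 2 : ℝ) ≤ _), mul_zero]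

theorem mul_eq_left_of_majorant {K : TopologicalSpace.Compacts (characterSpace ℂ M)} {g k : M}
    (hg : g ∈ majorants K) (hk : ∀ χ, χ ∉ K → χ k = 0) : k * g = k :=
  eq_of_forall_char_eq fun χ => by
    rw [map_mul]
    by_cases hχ : χ ∈ K
    · rw [hg.2 χ hχ, mul_one]
    · rw [hk χ hχ, zero_mul]

/-- The square root is taken by Gelfand duality on the spectrum of the unitization. This is how
positivity of functions on $\sigma(\mathfrak M)$ is transported to $\mathfrak A$ and its
unitization. -/
theorem exists_eq_star_mul_self (x : M) (hx : ∀ χ : characterSpace ℂ M, 0 ≤ χ x) :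
    ∃ y : M, x = star y * y := by
  let F : C(characterSpace ℂ (Unitization ℂ M), ℂ) :=
    ⟨fun ψ => (Real.sqrt (ψ (x : Unitization ℂ M)).re : ℂ),
      Complex.continuous_ofReal.comp (Real.continuous_sqrt.comp (Complex.continuous_re.comp
        ((WeakDual.eval_continuous (x : Unitization ℂ M)).comp continuous_subtype_val)))⟩
  obtain ⟨y, hy⟩ := (gelfandTransform_bijective (Unitization ℂ M)).2 F
  have hy' : ∀ ψ : characterSpace ℂ (Unitization ℂ M),
      ψ y = (Real.sqrt (ψ (x : Unitization ℂ M)).re : ℂ) := fun ψ => DFunLike.congr_fun hy ψ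
  -- The square root vanishes at infinity because `x` does, hence it already lies in `M`.
  have hfst : y.fst = 0 := by
    have hinf : ∀ z, (CharacterSpace.equivAlgHom.symm (Unitization.fstHom ℂ M)) z = z.fst :=
      fun _ => rfl
    rw [← hinf, hy', hinf]; simp
  refine ⟨y.snd, eq_of_forall_char_eq fun χ => ?_⟩
  have h1 : χ y.snd = (Real.sqrt (χ x).re : ℂ) := by
    have := hy' (extendChar χ)
    rw [extendChar_apply, extendChar_apply, hfst] at this
    simpa using this
  have h2 := Complex.le_def.1 (hx χ)
  rw [map_mul, char_star, h1, Complex.star_def, Complex.conj_ofReal, ← Complex.ofReal_mul,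
    Real.mul_self_sqrt h2.1]
  exact Complex.ext rfl h2.2.symm

end Majorants

/-! ### Positive functionals on a unital C⋆-algebra -/

section Positive

variable {B : Type*} [CStarAlgebra B] {φ : StrongDual ℂ B}

/-- Both $\|b\|1-b$ and $b+\|b\|1$ are positive, and $\varphi$ is real and nonnegative on them. -/
theorem abs_le_norm_of_isSelfAdjoint (hφ : ∀ b : B, 0 ≤ φ (star b * b)) (hφ1 : φ 1 = 1) {b : B}
    (hb : IsSelfAdjoint b) : ∃ t : ℝ, φ b = t ∧ |t| ≤ ‖b‖ := by
  let _ : PartialOrder B := CStarAlgebra.spectralOrder B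
  have _ : StarOrderedRing B := CStarAlgebra.spectralOrderedRing B
  have hpos : ∀ c : B, 0 ≤ c → 0 ≤ φ c := fun c hc => by
    obtain ⟨d, rfl⟩ := CStarAlgebra.nonneg_iff_eq_star_mul_self.1 hc
    exact hφ d
  have hr : ∀ r : ℝ, φ (algebraMap ℝ B r) = (r : ℂ) := fun r => by
    rw [IsScalarTower.algebraMap_apply ℝ ℂ B, Algebra.algebraMap_eq_smul_one, map_smul, hφ1]
    simp
  have h1 := hpos _ (sub_nonneg.2 hb.le_algebraMap_norm_self)
  have h2 := hpos _ (sub_nonneg.2 hb.neg_algebraMap_norm_le_self)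
  rw [map_sub, hr, Complex.le_def] at h1
  rw [map_sub, map_neg, hr, Complex.le_def] at h2
  have h3 : (φ b).im = 0 := by simpa using h1.2
  refine ⟨(φ b).re, Complex.ext rfl h3, abs_le.2 ⟨?_, ?_⟩⟩
  · simpa [neg_le_iff_add_nonneg] using h2.1
  · simpa using h1.1

/-- The real and imaginary parts of `b` contribute at most $\|b\|$ each. The sharp constant 1 is not
needed: only a bound uniform over all states matters. -/
theorem norm_le_two_of_positive (hφ : ∀ b : B, 0 ≤ φ (star b * b)) (hφ1 : φ 1 = 1) :
    ‖φ‖ ≤ 2 := by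
  refine φ.opNorm_le_bound zero_le_two fun b => ?_
  have h : ∀ c : selfAdjoint B, ‖φ c‖ ≤ ‖(c : B)‖ := fun c => by
    obtain ⟨t, ht, hle⟩ := abs_le_norm_of_isSelfAdjoint hφ hφ1 c.2
    rwa [ht, Complex.norm_real]
  calc ‖φ b‖ = ‖φ (realPart b : B) + Complex.I * φ (imaginaryPart b : B)‖ := by
        conv_lhs => rw [← realPart_add_I_smul_imaginaryPart b, map_add, map_smul, smul_eq_mul]
    _ ≤ ‖(realPart b : B)‖ + ‖(imaginaryPart b : B)‖ := by
        refine (norm_add_le _ _).trans (add_le_add (h _) ?_)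
        rw [norm_mul, Complex.norm_I, one_mul]
        exact h _
    _ ≤ ‖b‖ + ‖b‖ := add_le_add (realPart.norm_le b) (imaginaryPart.norm_le b)
    _ = 2 * ‖b‖ := (two_mul _).symm

theorem norm_one_le (B : Type*) [CStarAlgebra B] : ‖(1 : B)‖ ≤ 1 := by
  rcases subsingleton_or_nontrivial B with hB | hB
  · rw [Subsingleton.elim (1 : B) 0, norm_zero]; exact zero_le_one
  · exact CStarRing.norm_one.le

/-- A unital functional of norm at most one on a unital C⋆-algebra is positive. -/
theorem positive_of_norm_le_one (hφ : ‖φ‖ ≤ 1) (hφ1 : φ 1 = 1) (b : B) : 0 ≤ φ (star b * b) := by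
  let _ : PartialOrder B := CStarAlgebra.spectralOrder B
  have _ : StarOrderedRing B := CStarAlgebra.spectralOrderedRing B
  have hle : ∀ x : B, ‖φ x‖ ≤ ‖x‖ := fun x =>
    (φ.le_of_opNorm_le hφ x).trans (one_mul _).le
  set c := star b * b with hc
  have hsa : IsSelfAdjoint c := IsSelfAdjoint.star_mul_self b
  have h0 : 0 ≤ c := star_mul_self_nonneg b
  have him : (φ c).im = 0 := by
    -- Compare $|\varphi(c)-is|^2$ with $\|c-is1\|^2\le\|c\|^2+s^2$. The $s^2$ cancels and leaves an
    -- inequality affine in $s$, which for all real $s$ is possible only if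
    -- $\operatorname{Im}\varphi(c)=0$.
    have key : ∀ s : ℝ, (φ c).im ^ 2 - 2 * s * (φ c).im ≤ ‖c‖ ^ 2 := fun s => by
      have h1 : star (c - (s * Complex.I) • (1 : B)) * (c - (s * Complex.I) • (1 : B)) =
          c * c + ((s ^ 2 : ℝ) : ℂ) • (1 : B) := by
        have h2 : star ((s : ℂ) * Complex.I) = -(s * Complex.I) := by simp
        rw [star_sub, star_smul, star_one, hsa.star_eq, h2]
        simp only [sub_mul, mul_sub, smul_mul_assoc, mul_smul_comm, one_mul, mul_one, smul_sub,
          smul_smul]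
        have h3 : (s : ℂ) * Complex.I * (s * Complex.I) = -((s ^ 2 : ℝ) : ℂ) := by
          push_cast
          linear_combination (s : ℂ) ^ 2 * Complex.I_sq
        rw [mul_neg, h3, neg_neg, neg_smul]
        abel
      have h4 : ‖c - (s * Complex.I) • (1 : B)‖ ^ 2 ≤ ‖c‖ ^ 2 + s ^ 2 := by
        rw [sq, ← CStarRing.norm_star_mul_self, h1]
        refine (norm_add_le _ _).trans (add_le_add ((norm_mul_le c c).trans (sq _).ge) ?_)
        rw [norm_smul, Complex.norm_real, Real.norm_of_nonneg (sq_nonneg s)]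
        exact mul_le_of_le_one_right (sq_nonneg s) (norm_one_le B)
      have h5 := pow_le_pow_left₀ (norm_nonneg _) (hle (c - (s * Complex.I) • (1 : B))) 2
      have h6 : φ (c - (s * Complex.I) • (1 : B)) = φ c - s * Complex.I := by
        rw [map_sub, map_smul, hφ1, smul_eq_mul, mul_one]
      rw [h6, ← Complex.normSq_eq_norm_sq, Complex.normSq_apply] at h5
      simp only [Complex.sub_re, Complex.sub_im, Complex.mul_re, Complex.mul_im, Complex.ofReal_re,
        Complex.ofReal_im, Complex.I_re, Complex.I_im] at h5
      nlinarith [sq_nonneg (φ c).re]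
    by_contra hne
    -- This $s$ turns the left side into $(\operatorname{Im}\varphi(c))^2+\|c\|^2+1$, which exceeds
    -- $\|c\|^2$.
    have h := key (-(‖c‖ ^ 2 + 1) / (2 * (φ c).im))
    have h7 : 2 * (-(‖c‖ ^ 2 + 1) / (2 * (φ c).im)) * (φ c).im = -(‖c‖ ^ 2 + 1) := by
      field_simp
    rw [h7] at h
    nlinarith [sq_nonneg (φ c).im]
  have hre : 0 ≤ (φ c).re := by
    -- From $0\le\|c\|1-c\le\|c\|1$; applying $\varphi$ gives
    -- $\|c\|-\operatorname{Re}\varphi(c)\le\|c\|$.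
    have h1 : ‖algebraMap ℝ B ‖c‖ - c‖ ≤ ‖c‖ := by
      refine (CStarAlgebra.norm_le_norm_of_nonneg_of_le
        (sub_nonneg.2 hsa.le_algebraMap_norm_self) (sub_le_self _ h0)).trans ?_
      rw [Algebra.algebraMap_eq_smul_one, norm_smul, norm_norm]
      exact mul_le_of_le_one_right (norm_nonneg c) (norm_one_le B)
    have h2 : φ (algebraMap ℝ B ‖c‖ - c) = (‖c‖ : ℂ) - φ c := by
      rw [map_sub, IsScalarTower.algebraMap_apply ℝ ℂ B, Algebra.algebraMap_eq_smul_one, map_smul,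
        hφ1]
      simp
    have h3 := (Complex.re_le_norm _).trans ((hle _).trans h1)
    rw [h2, Complex.sub_re, Complex.ofReal_re] at h3
    linarith
  exact Complex.le_def.2 ⟨hre, him.symm⟩

end Positive

/-! ### The Lipschitz ball -/

namespace LipschitzPair

variable {A B : Type*} [NonUnitalCStarAlgebra A] [CStarAlgebra B] (P : LipschitzPair A B)

/-- Real multiples of the unit have seminorm zero. This allows a test element to be recentred at any
base state. -/
theorem sub_smul_one_mem_lipBall {b : B} (hb : b ∈ P.lipBall) (t : ℝ) :
    b - (t : ℂ) • (1 : B) ∈ P.lipBall := by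
  obtain ⟨hsa, hd, hL⟩ := hb
  obtain ⟨h1d, h1L⟩ := (P.lip_eq_zero_iff (t • (1 : selfAdjoint B))).2 ⟨t, rfl⟩
  have key : (b - (t : ℂ) • (1 : B)) =
      ((⟨b, hsa⟩ - t • (1 : selfAdjoint B) : selfAdjoint B) : B) := by
    simp
  have hsa' : IsSelfAdjoint (b - (t : ℂ) • (1 : B)) := by rw [key]; exact Subtype.property _
  have heq : (⟨b - (t : ℂ) • (1 : B), hsa'⟩ : selfAdjoint B) =
      ⟨b, hsa⟩ - t • (1 : selfAdjoint B) := Subtype.ext key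
  refine ⟨hsa', heq ▸ P.domain.sub_mem hd h1d, ?_⟩
  have h2 : (⟨⟨b - (t : ℂ) • (1 : B), hsa'⟩, heq ▸ P.domain.sub_mem hd h1d⟩ : P.domain) =
      ⟨⟨b, hsa⟩, hd⟩ - ⟨t • (1 : selfAdjoint B), h1d⟩ := Subtype.ext heq
  rw [h2]
  refine (map_sub_le_add P.lip _ _).trans ?_
  rw [h1L, add_zero]
  exact hL

/-- The elements of the domain are multiples of elements of the Lipschitz ball. -/
theorem exists_smul_mem_lipBall {a : selfAdjoint B} (ha : a ∈ P.domain) :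
    ∃ c : ℝ, 0 < c ∧ (c : ℂ) • (a : B) ∈ P.lipBall := by
  set r := P.lip ⟨a, ha⟩ with hr
  have hr0 : 0 ≤ r := apply_nonneg _ _
  -- Adding 1 covers the case $\mathsf L(a)=0$.
  refine ⟨(r + 1)⁻¹, by positivity, ?_⟩
  have key : (((r + 1)⁻¹ : ℝ) : ℂ) • (a : B) = (((r + 1)⁻¹ • a : selfAdjoint B) : B) := by
    rw [Complex.coe_smul]; rfl
  rw [key]
  refine ⟨Subtype.property _, P.domain.smul_mem _ ha, ?_⟩
  change P.lip ((r + 1)⁻¹ • ⟨a, ha⟩) ≤ 1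
  rw [map_smul_eq_mul, ← hr, Real.norm_of_nonneg (by positivity), inv_mul_le_iff₀ (by positivity)]
  linarith

/-- The Monge-Kantorovich metric also controls differences on self-adjoint elements of the
unitization. -/
theorem enorm_sub_le_mongeKantorovich {φ ψ : StrongDual ℂ B} (hφ : φ 1 = 1) (hψ : ψ 1 = 1) {b : B}
    (hb : b ∈ P.lipBall) : ‖φ b - ψ b‖ₑ ≤ P.mongeKantorovich φ ψ := by
  obtain ⟨a, t, rfl⟩ := P.isMinimalUnitization.exists_eq_add_smul_one b
  have hsa := hb.1
  have h2 : (2 : ℂ)⁻¹ + 2⁻¹ = 1 := by norm_num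
  -- The decomposition $b=\iota(a)+t1$ need not have `a` self-adjoint or `t` real. The self-adjoint
  -- part of `a` maps to $b-\operatorname{Re}(t)1$, and the scalar drops out of the difference of
  -- two states.
  set a' : A := (2 : ℂ)⁻¹ • (a + star a) with ha'
  have hsa' : IsSelfAdjoint a' := by
    rw [ha', IsSelfAdjoint, star_smul, star_add, star_star, add_comm (star a)]
    simp
  have key : P.incl a' = P.incl a + t • (1 : B) - (t.re : ℂ) • (1 : B) := by
    have h3 : star (P.incl a) = P.incl a + t • (1 : B) - star t • (1 : B) := by
      rw [← hsa.star_eq, star_add, star_smul, star_one]; abel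
    have h4 : (t.re : ℂ) = (2 : ℂ)⁻¹ * (t + star t) := by
      rw [Complex.star_def, Complex.re_eq_add_conj]; ring
    rw [ha', map_smul, map_add, map_star, h3, h4]
    module
  have hmem : P.incl a' ∈ P.lipBall := key ▸ P.sub_smul_one_mem_lipBall hb t.re
  have hval : φ (P.incl a + t • (1 : B)) - ψ (P.incl a + t • (1 : B)) =
      φ (P.incl a') - ψ (P.incl a') := by
    rw [key, map_sub φ, map_sub ψ, map_smul φ, map_smul ψ (t.re : ℂ), hφ, hψ]
    ring
  rw [hval]
  exact le_iSup_of_le a' (le_iSup₂_of_le hsa' hmem le_rfl)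

end LipschitzPair

/-! ### Corners by indicator functions and states on compact sets -/

namespace LipschitzTriple

variable {A M B : Type*} [NonUnitalCStarAlgebra A] [NonUnitalCommCStarAlgebra M] [CStarAlgebra B]
  (T : LipschitzTriple A M B)

theorem tendsto_ind (K : TopologicalSpace.Compacts (characterSpace ℂ M)) (f : StrongDual ℂ B) :
    Tendsto (fun g => f (T.incl (T.topography g))) (majorantFilter K) (𝓝 (T.ind K f)) :=
  tendsto_indicator K (f.comp (homToCLM (T.incl.comp T.topography)))

theorem ind_eq_of_forall_majorants {K : TopologicalSpace.Compacts (characterSpace ℂ M)}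
    {f : StrongDual ℂ B} {z : ℂ} (h : ∀ g ∈ majorants K, f (T.incl (T.topography g)) = z) :
    T.ind K f = z := by
  refine tendsto_nhds_unique (T.tendsto_ind K f) (tendsto_const_nhds.congr' ?_)
  obtain ⟨g, hg, -⟩ := exists_majorant K isOpen_univ (Set.subset_univ _)
  filter_upwards [(hasBasis_majorantFilter K).mem_of_mem hg] with k hk
  exact (h k hk.1).symm

theorem norm_ind_apply_le (K : TopologicalSpace.Compacts (characterSpace ℂ M))
    (f : StrongDual ℂ B) : ‖T.ind K f‖ ≤ ‖f‖ := by
  refine le_of_tendsto (T.tendsto_ind K f).norm ?_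
  obtain ⟨g, hg, -⟩ := exists_majorant K isOpen_univ (Set.subset_univ _)
  filter_upwards [(hasBasis_majorantFilter K).mem_of_mem hg] with k hk
  refine f.unit_le_opNorm _ ?_
  exact (NonUnitalStarAlgHom.norm_apply_le T.incl _).trans
    ((NonUnitalStarAlgHom.norm_apply_le T.topography _).trans (norm_le_one_of_majorant hk.1))

/-- The functional `b ↦ φ(b 1_K)`. -/
noncomputable def mulInd (K : TopologicalSpace.Compacts (characterSpace ℂ M))
    (φ : StrongDual ℂ B) : StrongDual ℂ B :=
  (T.ind K).comp ((ContinuousLinearMap.compL ℂ B B ℂ φ).comp (ContinuousLinearMap.mul ℂ B))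

theorem mulInd_apply (K : TopologicalSpace.Compacts (characterSpace ℂ M)) (φ : StrongDual ℂ B)
    (b : B) : T.mulInd K φ b = T.ind K (φ.comp (ContinuousLinearMap.mul ℂ B b)) :=
  rfl

theorem norm_mulInd_le (K : TopologicalSpace.Compacts (characterSpace ℂ M)) (φ : StrongDual ℂ B) :
    ‖T.mulInd K φ‖ ≤ ‖φ‖ := by
  refine ContinuousLinearMap.opNorm_le_bound _ (norm_nonneg _) fun b => ?_
  rw [mulInd_apply]
  refine (T.norm_ind_apply_le K _).trans ((ContinuousLinearMap.opNorm_comp_le _ _).trans ?_)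
  gcongr
  exact ContinuousLinearMap.opNorm_mul_apply_le ℂ B b

/-- The functional `b ↦ φ(b - 1_K b 1_K)`. -/
noncomputable def defect (K : TopologicalSpace.Compacts (characterSpace ℂ M))
    (φ : StrongDual ℂ B) : B →ₗ[ℂ] ℂ :=
  (φ : B →ₗ[ℂ] ℂ) - ((T.ind K).comp ((ContinuousLinearMap.compL ℂ B B ℂ (T.mulInd K φ)).comp
    (ContinuousLinearMap.mul ℂ B).flip) : B →L[ℂ] ℂ)

theorem defect_apply (K : TopologicalSpace.Compacts (characterSpace ℂ M)) (φ : StrongDual ℂ B)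
    (b : B) : T.defect K φ b =
      φ b - T.ind K ((T.mulInd K φ).comp ((ContinuousLinearMap.mul ℂ B).flip b)) :=
  rfl

/-- Unfolding the two Arens products gives the iterated expression in `defect`, so tameness can be
treated through a functional linear in `b`. -/
theorem inclusion_sub_corner_apply (K : TopologicalSpace.Compacts (characterSpace ℂ M))
    (φ : StrongDual ℂ B) (b : B) :
    (NormedSpace.inclusionInDoubleDual ℂ B b - T.corner K b) φ = T.defect K φ b :=
  rfl

theorem norm_defect_apply_le (K : TopologicalSpace.Compacts (characterSpace ℂ M))
    (φ : StrongDual ℂ B) (b : B) : ‖T.defect K φ b‖ ≤ 2 * ‖φ‖ * ‖b‖ := by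
  rw [defect_apply, mul_assoc, two_mul]
  refine (norm_sub_le _ _).trans (add_le_add (φ.le_opNorm b) ?_)
  refine (T.norm_ind_apply_le K _).trans ((ContinuousLinearMap.opNorm_comp_le _ _).trans ?_)
  gcongr
  · exact T.norm_mulInd_le K φ
  · refine ContinuousLinearMap.opNorm_le_bound _ (norm_nonneg _) fun c => ?_
    rw [ContinuousLinearMap.flip_apply, ContinuousLinearMap.mul_apply', mul_comm ‖b‖]
    exact norm_mul_le c b

/-- An element `k` of `M` supported in `K` satisfies `1_K k 1_K = k`. -/
theorem defect_eq_zero {K : TopologicalSpace.Compacts (characterSpace ℂ M)} {k : M}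
    (hk : ∀ χ, χ ∉ K → χ k = 0) (φ : StrongDual ℂ B) :
    T.defect K φ (T.incl (T.topography k)) = 0 := by
  rw [defect_apply, sub_eq_zero, eq_comm]
  refine T.ind_eq_of_forall_majorants fun g hg => ?_
  rw [ContinuousLinearMap.comp_apply, ContinuousLinearMap.flip_apply,
    ContinuousLinearMap.mul_apply', ← map_mul, ← map_mul, mul_comm g,
    mul_eq_left_of_majorant hg hk, mulInd_apply]
  refine T.ind_eq_of_forall_majorants fun h hh => ?_
  rw [ContinuousLinearMap.comp_apply, ContinuousLinearMap.mul_apply', ← map_mul, ← map_mul,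
    mul_eq_left_of_majorant hh hk]

/-- A majorant `g` of the larger set is also one of `K`, so
$1=\varphi(\chi_K)\le\varphi(g)\le\|g\|\le1$. Thus $\varphi$ is constantly 1 along the net defining
$\chi_{K'}$. -/
theorem localStatesOn_mono {K K' : TopologicalSpace.Compacts (characterSpace ℂ M)} (h : K ≤ K') :
    T.localStatesOn K ⊆ T.localStatesOn K' := by
  rintro φ ⟨hφ, hK⟩
  refine ⟨hφ, T.ind_eq_of_forall_majorants fun g hg => ?_⟩
  have hgK : g ∈ majorants K := ⟨hg.1, fun χ hχ => hg.2 χ (h hχ)⟩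
  have hpos : ∀ x : M, (∀ χ : characterSpace ℂ M, 0 ≤ χ x) →
      0 ≤ φ (T.incl (T.topography x)) := fun x hx => by
    obtain ⟨y, rfl⟩ := exists_eq_star_mul_self x hx
    rw [map_mul, map_mul, map_star, map_star]
    exact hφ.1 _
  have hle : 1 ≤ φ (T.incl (T.topography g)) := by
    rw [← hK]
    refine le_of_tendsto (T.tendsto_ind K φ) ?_
    filter_upwards [(hasBasis_majorantFilter K).mem_of_mem hgK] with k hk
    have := hpos (g - k) fun χ => by rw [map_sub]; exact sub_nonneg.2 (hk.2 χ)
    rwa [map_sub, map_sub, map_sub, sub_nonneg] at this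
  have hnorm : ‖T.incl (T.topography g)‖ ≤ 1 :=
    (NonUnitalStarAlgHom.norm_apply_le T.incl _).trans
      ((NonUnitalStarAlgHom.norm_apply_le T.topography _).trans (norm_le_one_of_majorant hg))
  have hsa : IsSelfAdjoint (T.incl (T.topography g)) := by
    obtain ⟨y, rfl⟩ := exists_eq_star_mul_self g fun χ => (hg.1 χ).1
    exact ((IsSelfAdjoint.star_mul_self y).map T.topography).map T.incl
  obtain ⟨t, ht, htn⟩ := abs_le_norm_of_isSelfAdjoint hφ.1 hφ.2.1 hsa
  rw [ht] at hle ⊢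
  have h1 : 1 ≤ t := by exact_mod_cast hle
  have h2 : t = 1 := le_antisymm ((le_abs_self t).trans (htn.trans hnorm)) h1
  rw [h2, Complex.ofReal_one]

theorem localStates_subset : T.localStates ⊆ T.stateSpace :=
  Set.iUnion_subset fun _ _ h => h.1

theorem IsRegular.mongeKantorovich_lt_top {T : LipschitzTriple A M B} (hT : T.IsRegular)
    {φ ψ : StrongDual ℂ B} (hφ : φ ∈ T.localStates) (hψ : ψ ∈ T.localStates) :
    T.mongeKantorovich φ ψ < ∞ := by
  obtain ⟨K, hK⟩ := Set.mem_iUnion.1 hφ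
  obtain ⟨K', hK'⟩ := Set.mem_iUnion.1 hψ
  refine lt_of_le_of_lt ?_ (hT (K ⊔ K'))
  exact le_iSup₂_of_le φ (T.localStatesOn_mono le_sup_left hK)
    (le_iSup₂_of_le ψ (T.localStatesOn_mono le_sup_right hK') le_rfl)

theorem isTameAt_iff (μ : StrongDual ℂ B) (𝒦 : Set (StrongDual ℂ B)) :
    T.IsTameAt μ 𝒦 ↔ ∀ ε : ℝ, 0 < ε → ∀ᶠ K in atTop, ∀ a ∈ T.lipBallAt μ, ∀ φ ∈ 𝒦,
      ‖T.defect K φ a‖ ≤ ε := by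
  have key : ∀ (K : TopologicalSpace.Compacts (characterSpace ℂ M)) (ε : ℝ),
      (⨆ a ∈ T.lipBallAt μ, ⨆ φ ∈ 𝒦,
        ‖(NormedSpace.inclusionInDoubleDual ℂ B a - T.corner K a) φ‖ₑ) ≤ ENNReal.ofReal ε ↔
      ∀ a ∈ T.lipBallAt μ, ∀ φ ∈ 𝒦, ‖T.defect K φ a‖ₑ ≤ ENNReal.ofReal ε := fun K ε => by
    simp only [iSup_le_iff, inclusion_sub_corner_apply]
  rw [IsTameAt, ENNReal.tendsto_nhds_zero]
  constructor
  · intro h ε hε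
    filter_upwards [h (ENNReal.ofReal ε) (ENNReal.ofReal_pos.2 hε)] with K hK a ha φ hφ
    have := (key K ε).1 hK a ha φ hφ
    rwa [← ofReal_norm, ENNReal.ofReal_le_ofReal_iff hε.le] at this
  · intro h ε hε
    obtain ⟨δ, hδ, hδε⟩ : ∃ δ : ℝ, 0 < δ ∧ ENNReal.ofReal δ ≤ ε := by
      obtain ⟨δ, h0, h1⟩ := ENNReal.lt_iff_exists_real_btwn.1 hε
      exact ⟨δ, ENNReal.ofReal_pos.1 h1.1, h1.2.le⟩
    filter_upwards [h δ hδ] with K hK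
    refine ((key K δ).2 fun a ha φ hφ => ?_).trans hδε
    rw [← ofReal_norm]
    exact ENNReal.ofReal_le_ofReal (hK a ha φ hφ)

/-! ### Tightness and change of base state -/

/-- A tame set of states is tight: `φ(1 - 1_K)` tends to `0` uniformly on it. -/
theorem IsTameAt.tight {T : LipschitzTriple A M B} {ν : StrongDual ℂ B} (hν : ν ∈ T.localStates)
    {𝒦 : Set (StrongDual ℂ B)} (h𝒦 : 𝒦 ⊆ T.stateSpace) (h : T.IsTameAt ν 𝒦) {ε : ℝ}
    (hε : 0 < ε) : ∀ᶠ K in atTop, ∀ φ ∈ 𝒦, ‖T.defect K φ 1‖ ≤ ε := by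
  obtain ⟨K₀, hνK⟩ := Set.mem_iUnion.1 hν
  obtain ⟨K₁, hK₁⟩ := exists_compactly_supported_majorant K₀
  -- The three error terms below are at most $\delta$, $12\delta$ and $4\delta$; any constant at
  -- least 17 would serve in place of 32.
  obtain ⟨δ, hδ, hδε⟩ : ∃ δ : ℝ, 0 < δ ∧ 32 * δ = ε := ⟨ε / 32, by positivity, by ring⟩
  have hlim := T.tendsto_ind K₀ ν
  rw [hνK.2] at hlim
  have hmaj : ∀ᶠ k in majorantFilter K₀, k ∈ majorants K₀ := by
    obtain ⟨g, hg, -⟩ := exists_majorant K₀ isOpen_univ (Set.subset_univ _)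
    filter_upwards [(hasBasis_majorantFilter K₀).mem_of_mem hg] with k hk using hk.1
  -- Support in `K₁` holds frequently along the majorants of `K₀`, and closeness of $\nu(k)$ to
  -- $\nu(\chi_{K_0})=1$ holds eventually, so a single `k` has both.
  obtain ⟨k, hk0, hkν, hk⟩ :=
    (hK₁.and_eventually ((Metric.tendsto_nhds.1 hlim δ hδ).and hmaj)).exists
  set p : B := T.incl (T.topography k) with hp
  have hpsa : IsSelfAdjoint p := by
    obtain ⟨y, hy⟩ := exists_eq_star_mul_self k fun χ => (hk.1 χ).1
    rw [hp, hy]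
    exact ((IsSelfAdjoint.star_mul_self y).map T.topography).map T.incl
  -- The element $1-p$ itself need not have finite seminorm, so it is replaced by a nearby element
  -- of the domain.
  obtain ⟨a, ha, hdist⟩ := Metric.dense_iff.1 T.dense_domain
    (⟨1 - p, (IsSelfAdjoint.one B).sub hpsa⟩ : selfAdjoint B) δ hδ |>.imp fun a h => h.symm
  have hanorm : ‖(a : B) - (1 - p)‖ ≤ δ := by
    rw [← dist_eq_norm]; exact (Metric.mem_ball.1 hdist).le
  obtain ⟨c, hc, hcb⟩ := T.exists_smul_mem_lipBall ha
  have hν1 := norm_le_two_of_positive hνK.1.1 hνK.1.2.1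
  obtain ⟨t, ht, -⟩ := abs_le_norm_of_isSelfAdjoint hνK.1.1 hνK.1.2.1 a.2
  have htle : |t| ≤ 3 * δ := by
    have h1 : (t : ℂ) = ν ((a : B) - (1 - p)) - (ν p - 1) := by
      rw [map_sub, map_sub, ht, hνK.1.2.1]; ring
    rw [← Real.norm_eq_abs, ← Complex.norm_real, h1]
    refine (norm_sub_le _ _).trans ?_
    have h2 : ‖ν ((a : B) - (1 - p))‖ ≤ 2 * δ :=
      (ν.le_opNorm _).trans (mul_le_mul hν1 hanorm (norm_nonneg _) zero_le_two)
    have h3 : ‖ν p - 1‖ < δ := by rw [← dist_eq_norm]; exact hkν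
    linarith
  -- This is $c(a-\nu(a)1)$: scaled into the Lipschitz ball and centred at $\nu$. The factor `c`
  -- does not depend on `K` or $\varphi$, so tameness may be invoked with tolerance $c\delta$.
  set b : B := (c : ℂ) • (a : B) - ((c * t : ℝ) : ℂ) • (1 : B) with hb
  have hbmem : b ∈ T.lipBallAt ν := by
    refine ⟨T.sub_smul_one_mem_lipBall hcb _, ?_⟩
    rw [hb, map_sub, map_smul, map_smul, ht, hνK.1.2.1]
    simp
  filter_upwards [(T.isTameAt_iff ν 𝒦).1 h (c * δ) (by positivity), eventually_ge_atTop K₁]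
    with K hK hKK₁ φ hφ
  have hφ2 := norm_le_two_of_positive (h𝒦 hφ).1 (h𝒦 hφ).2.1
  have hbd : ∀ x : B, ‖T.defect K φ x‖ ≤ 4 * ‖x‖ := fun x => by
    refine (T.norm_defect_apply_le K φ x).trans ?_
    gcongr
    linarith
  have hone := norm_one_le B
  have hp0 : T.defect K φ p = 0 :=
    T.defect_eq_zero (fun χ hχ => hk0 χ fun hχ' => hχ (hKK₁ hχ')) φ
  have hc' : (c : ℂ) ≠ 0 := by exact_mod_cast hc.ne'
  -- A test element for $\nu$ up to scale, a small scalar, a small approximation error, and the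
  -- compactly supported `p`, on which the defect vanishes.
  have hdec : (1 : B) = (c : ℂ)⁻¹ • b + (t : ℂ) • (1 : B) - ((a : B) - (1 - p)) + p := by
    rw [hb, smul_sub, smul_smul, smul_smul, Complex.ofReal_mul, inv_mul_cancel_left₀ hc',
      inv_mul_cancel₀ hc', one_smul]
    abel
  have h1 : ‖T.defect K φ ((c : ℂ)⁻¹ • b)‖ ≤ δ := by
    rw [map_smul, norm_smul, norm_inv, Complex.norm_real, Real.norm_of_nonneg hc.le,
      inv_mul_le_iff₀ hc]
    exact hK b hbmem φ hφ
  have h2 : ‖T.defect K φ ((t : ℂ) • (1 : B))‖ ≤ 12 * δ := by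
    refine (hbd _).trans ?_
    rw [norm_smul, Complex.norm_real, Real.norm_eq_abs]
    nlinarith [abs_nonneg t, norm_nonneg (1 : B)]
  have h3 := hbd ((a : B) - (1 - p))
  rw [hdec, map_add, hp0, add_zero, map_sub, map_add]
  have h4 := norm_sub_le (T.defect K φ ((c : ℂ)⁻¹ • b) + T.defect K φ ((t : ℂ) • (1 : B)))
    (T.defect K φ ((a : B) - (1 - p)))
  have h5 := norm_add_le (T.defect K φ ((c : ℂ)⁻¹ • b)) (T.defect K φ ((t : ℂ) • (1 : B)))
  linarith

/-- In a regular Lipschitz triple, tameness does not depend on the base state. -/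
theorem IsTameAt.change_base {T : LipschitzTriple A M B} (hT : T.IsRegular)
    {μ ν : StrongDual ℂ B} (hμ : μ ∈ T.localStates) (hν : ν ∈ T.localStates)
    {𝒦 : Set (StrongDual ℂ B)} (h𝒦 : 𝒦 ⊆ T.stateSpace) (h : T.IsTameAt ν 𝒦) :
    T.IsTameAt μ 𝒦 := by
  rw [isTameAt_iff]
  intro ε hε
  have hμs := T.localStates_subset hμ
  have hνs := T.localStates_subset hν
  set D : ℝ := (T.mongeKantorovich ν μ).toReal with hD
  have hD0 : 0 ≤ D := ENNReal.toReal_nonneg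
  -- The denominator is $D+1$ because $D$ may be zero.
  filter_upwards [(T.isTameAt_iff ν 𝒦).1 h (ε / 2) (half_pos hε),
    h.tight hν h𝒦 (ε := ε / 2 / (D + 1)) (by positivity)] with K hK hK1 a ha φ hφ
  obtain ⟨t, ht, -⟩ := abs_le_norm_of_isSelfAdjoint hνs.1 hνs.2.1 ha.1.1
  -- As $\mu(a)=0$, the scalar $t$ equals $\nu(a)-\mu(a)$; finiteness of the distance makes its real
  -- value $D$ a genuine bound.
  have htD : |t| ≤ D := by
    have h1 := T.enorm_sub_le_mongeKantorovich hνs.2.1 hμs.2.1 ha.1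
    have h2 := ENNReal.toReal_mono (hT.mongeKantorovich_lt_top hν hμ).ne h1
    rwa [ha.2, sub_zero, ht, toReal_enorm, Complex.norm_real, Real.norm_eq_abs] at h2
  have hmem : a - (t : ℂ) • (1 : B) ∈ T.lipBallAt ν := by
    refine ⟨T.sub_smul_one_mem_lipBall ha.1 t, ?_⟩
    rw [map_sub, map_smul, ht, hνs.2.1]
    simp
  have h1 := hK _ hmem φ hφ
  have h2 : ‖(t : ℂ) • T.defect K φ 1‖ ≤ ε / 2 := by
    rw [norm_smul, Complex.norm_real, Real.norm_eq_abs]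
    calc |t| * ‖T.defect K φ 1‖ ≤ (D + 1) * (ε / 2 / (D + 1)) :=
          mul_le_mul (by linarith) (hK1 φ hφ) (norm_nonneg _) (by positivity)
      _ = ε / 2 := by field_simp
  have h3 : T.defect K φ a = T.defect K φ (a - (t : ℂ) • (1 : B)) + (t : ℂ) • T.defect K φ 1 := by
    rw [map_sub, map_smul]; abel
  rw [h3]
  exact (norm_add_le _ _).trans (by linarith)

/-! ### Existence of a local state -/

/-- If `M` were zero, the approximate unit would eventually be 0, forcing every element of `A` to
vanish. -/
theorem exists_ne_zero (T : LipschitzTriple A M B) [Nontrivial A] : ∃ x : M, x ≠ 0 := by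
  by_contra! h
  obtain ⟨l, hl, hmem⟩ := T.exists_approximateUnit
  have := hl.neBot
  have h0 : ∀ᶠ a in l, a = 0 := by
    filter_upwards [hmem]
    rintro _ ⟨x, rfl⟩
    rw [h x, map_zero]
  obtain ⟨m, hm⟩ := _root_.exists_ne (0 : A)
  refine hm (tendsto_nhds_unique (hl.tendsto_mul_left m) (tendsto_const_nhds.congr' ?_))
  filter_upwards [h0] with a ha
  rw [ha, mul_zero]

theorem norm_incl_topography (x : M) : ‖T.incl (T.topography x)‖ = ‖x‖ := by
  rw [NonUnitalStarAlgHom.norm_map T.incl T.isMinimalUnitization.injective,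
    NonUnitalStarAlgHom.norm_map T.topography T.topography_injective]

/-- Every character of `M` extends to a functional of norm at most one on the unitization. -/
theorem exists_extension (χ : characterSpace ℂ M) : ∃ φ : StrongDual ℂ B,
    (∀ x : M, φ (T.incl (T.topography x)) = χ x) ∧ ‖φ‖ ≤ 1 := by
  let j : M →ₗ[ℂ] B := (homToCLM (T.incl.comp T.topography) : M →L[ℂ] B)
  have hj : ∀ x, j x = T.incl (T.topography x) := fun _ => rfl
  have hinj : Function.Injective j :=
    T.isMinimalUnitization.injective.comp T.topography_injective
  let e := LinearEquiv.ofInjective j hinj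
  have hχ : ∀ x : M, ‖χ x‖ ≤ ‖x‖ := fun x => by
    have := AlgHom.norm_apply_le_self (CharacterSpace.equivAlgHom (extendChar χ))
      (x : Unitization ℂ M)
    rw [Unitization.norm_inr] at this
    refine le_trans (le_of_eq ?_) this
    change _ = ‖extendChar χ (x : Unitization ℂ M)‖
    rw [extendChar_apply, Unitization.fst_inr, Unitization.snd_inr, zero_add]
  let f : StrongDual ℂ (LinearMap.range j) :=
    LinearMap.mkContinuous ((CharacterSpace.toCLM χ : M →ₗ[ℂ] ℂ).comp e.symm.toLinearMap) 1
      fun y => by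
        obtain ⟨x, rfl⟩ := e.surjective y
        have h1 : ‖e x‖ = ‖x‖ := T.norm_incl_topography x
        rw [one_mul, h1, LinearMap.comp_apply, LinearEquiv.coe_coe, LinearEquiv.symm_apply_apply]
        exact hχ x
  obtain ⟨φ, hφ, hn⟩ := exists_extension_norm_eq (LinearMap.range j) f
  refine ⟨φ, fun x => ?_, hn.le.trans (LinearMap.mkContinuous_norm_le _ zero_le_one _)⟩
  have h1 : f (e x) = χ x := by
    change χ (e.symm (e x)) = χ x
    rw [LinearEquiv.symm_apply_apply]
  rw [← h1, ← hφ]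
  rfl

/-- With $p$ the image of $g$, $0\le g\le1$ gives $(2p-1)^2=1-4(p-p^2)\le1$. This serves to show
that an extended character is unital. -/
theorem norm_two_smul_sub_one_le {K : TopologicalSpace.Compacts (characterSpace ℂ M)} {g : M}
    (hg : g ∈ majorants K) : ‖(2 : ℂ) • T.incl (T.topography g) - 1‖ ≤ 1 := by
  let _ : PartialOrder B := CStarAlgebra.spectralOrder B
  have _ : StarOrderedRing B := CStarAlgebra.spectralOrderedRing B
  have hsa : IsSelfAdjoint (T.incl (T.topography g)) := by
    obtain ⟨y, rfl⟩ := exists_eq_star_mul_self g fun χ => (hg.1 χ).1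
    exact ((IsSelfAdjoint.star_mul_self y).map T.topography).map T.incl
  obtain ⟨y, hy⟩ := exists_eq_star_mul_self (g - g * g) fun χ => by
    rw [map_sub, map_mul, sub_nonneg]
    exact mul_le_of_le_one_left (hg.1 χ).1 (hg.1 χ).2
  set p := T.incl (T.topography g) with hp
  have hpos : 0 ≤ p - p * p := by
    rw [hp, ← map_mul, ← map_mul, ← map_sub, ← map_sub, hy, map_mul, map_mul, map_star, map_star]
    exact star_mul_self_nonneg _
  have hx : star ((2 : ℂ) • p - 1) * ((2 : ℂ) • p - 1) = 1 - (4 : ℕ) • (p - p * p) := by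
    rw [star_sub, star_smul, star_one, hsa.star_eq]
    simp only [two_smul, star_ofNat]
    noncomm_ring
  have h1 : ‖(2 : ℂ) • p - 1‖ * ‖(2 : ℂ) • p - 1‖ ≤ 1 := by
    rw [← CStarRing.norm_star_mul_self]
    refine (CStarAlgebra.norm_le_norm_of_nonneg_of_le (star_mul_self_nonneg _) ?_).trans
      (norm_one_le B)
    rw [hx]
    exact sub_le_self _ (nsmul_nonneg hpos 4)
  nlinarith [norm_nonneg ((2 : ℂ) • p - 1)]

/-- Extensions of characters of `M` are local states. -/
theorem localStates_nonempty [Nontrivial A] : T.localStates.Nonempty := by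
  obtain ⟨x, hx⟩ := T.exists_ne_zero
  obtain ⟨χ⟩ : Nonempty (characterSpace ℂ M) := by
    by_contra h
    rw [not_nonempty_iff] at h
    exact hx (eq_of_forall_char_eq fun χ => isEmptyElim χ)
  obtain ⟨φ, hφχ, hφn⟩ := T.exists_extension χ
  let K : TopologicalSpace.Compacts (characterSpace ℂ M) := ⟨{χ}, isCompact_singleton⟩
  have hK : ∀ g ∈ majorants K, φ (T.incl (T.topography g)) = 1 := fun g hg => by
    rw [hφχ]; exact hg.2 χ rfl
  obtain ⟨g, hg, -⟩ := exists_majorant K isOpen_univ (Set.subset_univ _)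
  have hle : ∀ b : B, ‖b‖ ≤ 1 → ‖φ b‖ ≤ 1 := fun b hb =>
    (φ.unit_le_opNorm b hb).trans hφn
  -- Since $\varphi(g)=1$, the contractive functional satisfies $|2-\varphi(1)|\le1$ as well as
  -- $|\varphi(1)|\le1$; the two discs meet only at 1.
  have hφ1 : φ 1 = 1 := by
    have h1 := hle _ (norm_one_le B)
    have h2 := hle _ (T.norm_two_smul_sub_one_le hg)
    rw [map_sub, map_smul, hK g hg, smul_eq_mul, mul_one] at h2
    have h3 := (Complex.re_le_norm _).trans h2
    rw [Complex.sub_re, Complex.re_ofNat] at h3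
    have h4 : ‖φ 1‖ ^ 2 ≤ 1 := pow_le_one₀ (norm_nonneg _) h1
    rw [← Complex.normSq_eq_norm_sq, Complex.normSq_apply] at h4
    refine Complex.ext ?_ ?_
    · rw [Complex.one_re]
      nlinarith [mul_self_nonneg (φ 1).im]
    · rw [Complex.one_im]
      nlinarith [mul_self_nonneg (φ 1).im]
  refine ⟨φ, Set.mem_iUnion.2 ⟨K, ⟨positive_of_norm_le_one hφn hφ1, hφ1, le_antisymm ?_ ?_⟩,
    T.ind_eq_of_forall_majorants hK⟩⟩
  · refine ContinuousLinearMap.opNorm_le_bound _ zero_le_one fun a => ?_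
    refine (φ.le_of_opNorm_le hφn _).trans ?_
    gcongr
    exact NonUnitalStarAlgHom.norm_apply_le T.incl a
  -- The norm on `A` is attained at the majorant `g`, so no mass escapes to the adjoined unit.
  · have h1 := (φ.comp (homToCLM T.incl)).unit_le_opNorm (T.topography g)
      ((NonUnitalStarAlgHom.norm_apply_le T.topography _).trans (norm_le_one_of_majorant hg))
    have h2 : (φ.comp (homToCLM T.incl)) (T.topography g) = 1 := hK g hg
    rwa [h2, norm_one] at h1

end LipschitzTriple
end QLCMS

theorem mainTheorem7 {A M B : Type*} [NonUnitalCStarAlgebra A] [Nontrivial A]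
    [NonUnitalCommCStarAlgebra M] [CStarAlgebra B] (T : QLCMS.LipschitzTriple A M B)
    (hT : T.IsRegular) (𝒦 : Set (StrongDual ℂ B)) (h𝒦 : 𝒦 ⊆ T.stateSpace) :
    (T.IsTame 𝒦 ↔ ∀ μ ∈ T.localStates, T.IsTameAt μ 𝒦) ∧
      ∀ μ ∈ T.localStates, ∀ ν ∈ T.localStates, (T.IsTameAt μ 𝒦 ↔ T.IsTameAt ν 𝒦) := by
  refine ⟨⟨?_, ?_⟩, fun μ hμ ν hν =>
    ⟨fun h => h.change_base hT hν hμ h𝒦, fun h => h.change_base hT hμ hν h𝒦⟩⟩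
  · rintro ⟨ν, hν, h⟩ μ hμ
    exact h.change_base hT hμ hν h𝒦
  · intro h
    obtain ⟨μ, hμ⟩ := T.localStates_nonempty
    exact ⟨μ, hμ, h μ hμ⟩
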